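/- A $2$-colouring of $K_n$ is a colouring of the edges of the complete graph $K_n$ in red and blue; it is called locally $\delta$-balanced if every vertex is incident to at least $\delta n$ red edges and at least $\delta n$ blue edges. It is said to contain a $t$-blow-up of $P_1$ if there are disjoint sets $V_1,V_2$ of $t$ vertices each such that all edges inside $V_1$ and inside $V_2$ are red and all edges between $V_1$ and $V_2$ are blue; a $t$-blow-up of $\overline{P_1}$ is the same with the two colours interchanged. **Theorem.** There is an absolute constant $C>0$ such that the following holds for all $\varepsilon>0$ and all non-negative integers $t,n$ with $$n\ \ge\ 2^{\,t\cdot 2^{\,C(\log(1/\varepsilon))^8}}.$$ Every locally $(1/4+\varepsilon)$-balanced $2$-colouring of $K_n$ contains a $t$-blow-up of $P_1$ or of $\overline{P_1}$; in other words, it contains $2t$ vertices on which the edges of one of the colours form exactly a $K_{t,t}$. The threshold $1/4$ is sharp. For $k\ge 1$ let $\mathcal P_k$ be the following $2$-colouring of $K_{4k}$: partition the vertices into sets $V_1,V_2,V_3,V_4$ of size $k$; colour red all edges inside $V_1\cup V_4$, all edges between $V_1$ and $V_3$, and all edges between $V_2$ and $V_4$; colour blue all edges inside $V_2\cup V_3$,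 all edges between $V_1$ and $V_2$, and all edges between $V_3$ and $V_4$. Then $\mathcal P_k$ is locally $1/4$-balanced, but for every $t\ge 2$ it contains no $t$-blow-up of $P_1$ or of $\overline{P_1}$; that is, it has no $2t$ vertices on which the edges of one of the colours form exactly a $K_{t,t}$. -/

import Mathlib

namespace BalancedRamsey

/-- The two colours. -/
inductive Colour
  | red
  | blue
  deriving DecidableEq

/-- Interchange the two colours. -/
def Colour.swap : Colour → Colour
  | .red => .blue
  | .blue => .red

/-- A 2-edge-colouring of the complete graph on the vertex set `V`. The graph formed by the edges
of colour `c` in the colouring `χ` is `χ.labelGraph c`. -/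
abbrev Colouring (V : Type*) := SimpleGraph.TopEdgeLabeling V Colour

/-- Each vertex is incident to at least `ε |V|` edges of each colour. -/
def LocallyBalanced {V : Type*} [Fintype V] (ε : ℝ) (χ : Colouring V) : Prop :=
  ∀ (v : V) (c : Colour),
    ε * (Fintype.card V : ℝ) ≤ (((χ.labelGraph c).neighborSet v).ncard : ℝ)

/-- A totally 2-coloured graph: both its edges and its vertices carry a colour. -/
structure TotallyColouredGraph (W : Type*) where
  graph : SimpleGraph W
  edgeColour : graph.EdgeLabeling Colour
  vertexColour : W → Colour

/-- The totally-coloured graph with the two colours interchanged. -/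
def TotallyColouredGraph.bar {W : Type*} (H : TotallyColouredGraph W) :
    TotallyColouredGraph W where
  graph := H.graph
  edgeColour := H.edgeColour.compRight Colour.swap
  vertexColour := fun i => (H.vertexColour i).swap

/-- The 2-coloured complete graph `χ` contains a `t`-blow-up of the totally-coloured graph `H`:
there are pairwise disjoint sets `S i` of `t` vertices, one for each vertex `i` of `H`, such that
`S i` is a monochromatic clique in the colour of `i`, and all edges between `S i` and `S j` have
the colour of the edge `ij` whenever `ij` is an edge of `H`. -/
def ContainsBlowUp {V W : Type*} (χ : Colouring V) (t : ℕ) (H : TotallyColouredGraph W) : Prop :=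
  ∃ S : W → Finset V,
    (∀ i, (S i).card = t) ∧
    (∀ i j, i ≠ j → Disjoint (S i) (S j)) ∧
    (∀ i, ∀ x ∈ S i, ∀ y ∈ S i, x ≠ y → (χ.labelGraph (H.vertexColour i)).Adj x y) ∧
    (∀ i j, ∀ h : H.graph.Adj i j, ∀ x ∈ S i, ∀ y ∈ S j,
      (χ.labelGraph (H.edgeColour.get i j h)).Adj x y)

/-- `P₁`: the totally-coloured `K₂` with both vertices red and the edge blue. -/
def P₁ : TotallyColouredGraph (Fin 2) where
  graph := ⊤
  edgeColour := fun _ => Colour.blue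
  vertexColour := fun _ => Colour.red

/-- There are `2t` vertices on which the edges of one of the two colours form exactly
a `K_{t,t}`. -/
def HasInducedBipartite {V : Type*} (χ : Colouring V) (t : ℕ) : Prop :=
  ∃ (c : Colour) (S : Finset V), S.card = 2 * t ∧
    Nonempty ((χ.labelGraph c).induce (S : Set V) ≃g completeBipartiteGraph (Fin t) (Fin t))

/-- The colours inside and between the four parts `V₁, V₂, V₃, V₄` (indexed from `0`):
red inside `V₁ ∪ V₄`, blue inside `V₂ ∪ V₃`, red between `V₁, V₃` and between `V₂, V₄`,
blue between `V₁, V₂` and between `V₃, V₄`. -/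
def partColour : Fin 4 → Fin 4 → Colour :=
  ![![.red,  .blue, .red,  .red],
    ![.blue, .blue, .blue, .red],
    ![.red,  .blue, .blue, .blue],
    ![.red,  .red,  .blue, .red]]

theorem partColour_comm : ∀ i j : Fin 4, partColour j i = partColour i j := by
  decide

/-- The 2-coloured complete graph `𝒫_k` on `4k` vertices; the part `V_{i+1}` is the set of
vertices with first coordinate `i`. -/
def fourPart (k : ℕ) : Colouring (Fin 4 × Fin k) :=
  SimpleGraph.EdgeLabeling.mk (fun x y _ => partColour x.1 y.1)
    (fun x y _ => partColour_comm x.1 y.1)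

end BalancedRamsey

namespace BalancedRamsey

open Finset

/-! Write `G` for the red graph. Ramsey's theorem splits the vertices into `A = Bᶜ`, whose
moderately large subsets all contain red `T`-cliques, and `B`, likewise for blue
(`exists_cliqueRich_split`). If separated red cliques are absent, blue has density about `t / T`
inside `A`: few vertices of `A` have `t` blue neighbours in a given red `T`-clique
(`mul_sum_card_compl_adj_le`). Similarly red is sparse inside `B`. Now add the blue degrees over `A`
to the red degrees over `B`. Balance gives at least `(1/4 + ε) n²`. Each cross pair counts once, for
a total of `|A||B| ≤ n²/4`, so the sparse inner terms would have to reach `ε n²`. With `T = tK`, `K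
≥ 3/ε`, they do not. This needs only `n ≥ 2 ^ (10tK)`, well below the stated bound. -/

variable {V : Type*}

/-- Two `G`-cliques on `t` vertices each with no `G`-edge between them. -/
def HasSeparatedCliques (G : SimpleGraph V) (t : ℕ) : Prop :=
  ∃ S S' : Finset V, S.card = t ∧ S'.card = t ∧ G.IsClique S ∧ G.IsClique S' ∧
    ∀ x ∈ S, ∀ y ∈ S', Gᶜ.Adj x y

/-- Every subset of `Z` with at least `ρ` elements contains a `G`-clique on `T` vertices. -/
def CliqueRich (G : SimpleGraph V) (T ρ : ℕ) (Z : Finset V) : Prop :=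
  ∀ W ⊆ Z, ρ ≤ W.card → ∃ S ⊆ W, S.card = T ∧ G.IsClique S

lemma CliqueRich.mono {G : SimpleGraph V} {T ρ ρ' : ℕ} {Z : Finset V}
    (h : CliqueRich G T ρ Z) (hρ : ρ ≤ ρ') : CliqueRich G T ρ' Z :=
  fun W hW hc => h W hW (hρ.trans hc)

/-! ### Ramsey's theorem and the splitting into rich parts -/

theorem exists_clique_or_compl_clique (G : SimpleGraph V) (k : ℕ) :
    ∀ a b : ℕ, a + b = k → ∀ W : Finset V, 2 ^ k ≤ W.card →
      (∃ S ⊆ W, S.card = a ∧ G.IsClique S) ∨ (∃ S ⊆ W, S.card = b ∧ Gᶜ.IsClique S) := by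
  classical
  induction k with
  | zero =>
    intro a b hab W _
    exact Or.inl ⟨∅, by simp, by simp; omega, by simp⟩
  | succ k ih =>
    intro a b hab W hW
    rcases a with _ | a
    · exact Or.inl ⟨∅, by simp, by simp, by simp⟩
    rcases b with _ | b
    · exact Or.inr ⟨∅, by simp, by simp, by simp⟩
    obtain ⟨v, hv⟩ : W.Nonempty := by
      rw [← card_pos]; exact lt_of_lt_of_le (by positivity) hW
    set N := (W.erase v).filter (G.Adj v) with hN
    set M := (W.erase v).filter (fun x => ¬ G.Adj v x) with hM
    have hsum : N.card + M.card = W.card - 1 := by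
      rw [hN, hM, card_filter_add_card_filter_not, card_erase_of_mem hv]
    have hNW : N ⊆ W := (filter_subset _ _).trans (erase_subset _ _)
    have hMW : M ⊆ W := (filter_subset _ _).trans (erase_subset _ _)
    have hvN : v ∉ N := by simp [hN]
    have hvM : v ∉ M := by simp [hM]
    have hpow : 2 ^ (k + 1) = 2 ^ k + 2 ^ k := by ring
    by_cases hc : 2 ^ k ≤ N.card
    · rcases ih a (b + 1) (by omega) N hc with ⟨S, hS, hcard, hcl⟩ | ⟨S, hS, hcard, hcl⟩
      · refine Or.inl ⟨insert v S, insert_subset hv (hS.trans hNW), ?_, ?_⟩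
        · rw [card_insert_of_notMem (fun h => hvN (hS h)), hcard]
        · rw [coe_insert, SimpleGraph.isClique_insert]
          exact ⟨hcl, fun x hx _ => (mem_filter.1 (hS hx)).2⟩
      · exact Or.inr ⟨S, hS.trans hNW, hcard, hcl⟩
    · rcases ih (a + 1) b (by omega) M (by omega) with ⟨S, hS, hcard, hcl⟩ | ⟨S, hS, hcard, hcl⟩
      · exact Or.inl ⟨S, hS.trans hMW, hcard, hcl⟩
      · refine Or.inr ⟨insert v S, insert_subset hv (hS.trans hMW), ?_, ?_⟩
        · rw [card_insert_of_notMem (fun h => hvM (hS h)), hcard]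
        · rw [coe_insert, SimpleGraph.isClique_insert]
          exact ⟨hcl, fun x hx hne =>
            (SimpleGraph.compl_adj _ _ _).2 ⟨hne, (mem_filter.1 (hS hx)).2⟩⟩

/-- The vertex set splits into a part rich in cliques and a part rich in independent sets. -/
theorem exists_cliqueRich_split [Fintype V] [DecidableEq V] (G : SimpleGraph V) (T m : ℕ)
    (hm : 0 < m) :
    ∃ B : Finset V, CliqueRich G T m Bᶜ ∧
      ∃ k : ℕ, k * m ≤ Fintype.card V ∧ CliqueRich Gᶜ T (k * 2 ^ (T + T) + 1) B := by
  classical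
  -- `B` is a union of `k` disjoint `m`-blocks without `T`-cliques, with `k` maximal. The `+ 1`
  -- makes `B = ∅` valid: no subset of it reaches the threshold.
  let Q : ℕ → Prop := fun k =>
    ∃ B : Finset V, B.card = k * m ∧ CliqueRich Gᶜ T (k * 2 ^ (T + T) + 1) B
  have hQ0 : Q 0 := ⟨∅, by simp, fun W hW hc => by
    rw [subset_empty.1 hW] at hc; simp at hc⟩
  have hbd : ∀ k, Q k → k * m ≤ Fintype.card V := by
    rintro k ⟨B, hB, _⟩
    rw [← hB]; exact card_le_univ B
  have hbd' : ∀ k, Q k → k ≤ Fintype.card V := fun k hk =>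
    (Nat.le_mul_of_pos_right k hm).trans (hbd k hk)
  set k := Nat.findGreatest Q (Fintype.card V) with hk
  have hQk : Q k := Nat.findGreatest_spec (Nat.zero_le _) hQ0
  obtain ⟨B, hB, hrich⟩ := hQk
  refine ⟨B, ?_, k, hbd k ⟨B, hB, hrich⟩, hrich⟩
  by_contra hA
  unfold CliqueRich at hA
  push Not at hA
  obtain ⟨W, hWB, hWc, hW⟩ := hA
  obtain ⟨S, hSW, hSc⟩ := exists_subset_card_eq hWc
  have hdisj : Disjoint B S :=
    disjoint_left.2 fun x hxB hxS => (mem_compl.1 (hWB (hSW hxS))) hxB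
  have hQ : Q (k + 1) := by
    refine ⟨B ∪ S, by rw [card_union_of_disjoint hdisj, hB, hSc]; ring, fun X hX hXc => ?_⟩
    have hsplit : X.card ≤ (X ∩ B).card + (X ∩ S).card := by
      refine le_trans (card_le_card ?_) (card_union_le _ _)
      rw [← inter_union_distrib_left]
      exact subset_inter subset_rfl hX
    -- By pigeonhole `X` is large in the old `B` or has `2 ^ (T + T)` vertices in the clique-free
    -- block, where Ramsey yields an independent set.
    by_cases h1 : k * 2 ^ (T + T) + 1 ≤ (X ∩ B).card
    · obtain ⟨R, hR, h⟩ := hrich _ inter_subset_right h1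
      exact ⟨R, hR.trans inter_subset_left, h⟩
    · have h2 : 2 ^ (T + T) ≤ (X ∩ S).card := by
        rw [add_mul] at hXc
        omega
      rcases exists_clique_or_compl_clique G (T + T) T T rfl _ h2 with
        ⟨R, hR, hRc, hcl⟩ | ⟨R, hR, h⟩
      · exact absurd hcl (hW R (hR.trans (inter_subset_right.trans hSW)) hRc)
      · exact ⟨R, hR.trans inter_subset_left, h⟩
  have := Nat.le_findGreatest (hbd' _ hQ) hQ
  omega

/-! ### Sparsity of the complement inside a rich set -/

open scoped Classical in
theorem sum_card_compl_adj_clique_le (G : SimpleGraph V) {t T ρ : ℕ} (htT : t ≤ T)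
    (hG : ¬ HasSeparatedCliques G t) {Z R : Finset V} (hZ : CliqueRich G T ρ Z)
    (hRc : R.card = T) (hR : G.IsClique R) :
    ∑ x ∈ R, (Z.filter (Gᶜ.Adj x)).card ≤ t * Z.card + T * (2 ^ T * ρ) := by
  -- Each `t`-subset of `R` has at most `ρ` common non-neighbours in `Z`; otherwise richness would
  -- supply the second separated clique. There are at most `2 ^ T` such subsets.
  set Y := Z.filter (fun y => t ≤ (R.filter (fun x => Gᶜ.Adj x y)).card) with hY
  have hYcard : Y.card ≤ 2 ^ T * ρ := by
    have hsub : Y ⊆ (R.powersetCard t).biUnion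
        (fun S => Z.filter (fun y => ∀ x ∈ S, Gᶜ.Adj x y)) := by
      intro y hy
      obtain ⟨hyZ, hyt⟩ := mem_filter.1 hy
      obtain ⟨S, hS, hSc⟩ := exists_subset_card_eq hyt
      refine mem_biUnion.2 ⟨S, mem_powersetCard.2 ⟨hS.trans (filter_subset _ _), hSc⟩, ?_⟩
      exact mem_filter.2 ⟨hyZ, fun x hx => (mem_filter.1 (hS hx)).2⟩
    have hpiece : ∀ S ∈ R.powersetCard t,
        (Z.filter (fun y => ∀ x ∈ S, Gᶜ.Adj x y)).card ≤ ρ := by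
      intro S hS
      obtain ⟨hSR, hSc⟩ := mem_powersetCard.1 hS
      by_contra hlt
      obtain ⟨S', hS', hSc', hcl⟩ := hZ _ (filter_subset _ _) (not_le.1 hlt).le
      obtain ⟨S'', hS'', hSc''⟩ := exists_subset_card_eq (htT.trans hSc'.ge)
      exact hG ⟨S, S'', hSc, hSc'', hR.subset (by exact_mod_cast hSR),
        hcl.subset (by exact_mod_cast hS''),
        fun x hx y hy => (mem_filter.1 (hS' (hS'' hy))).2 x hx⟩
    calc Y.card ≤ _ := card_le_card hsub
      _ ≤ (R.powersetCard t).card * ρ := card_biUnion_le_card_mul _ _ _ hpiece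
      _ ≤ 2 ^ T * ρ := by
        gcongr
        rw [card_powersetCard, hRc]
        exact Nat.choose_le_two_pow T t
  calc ∑ x ∈ R, (Z.filter (Gᶜ.Adj x)).card
      = ∑ y ∈ Z, (R.filter (fun x => Gᶜ.Adj x y)).card :=
        sum_card_bipartiteAbove_eq_sum_card_bipartiteBelow _
    _ ≤ ∑ y ∈ Z, (t + if y ∈ Y then T else 0) := by
        refine sum_le_sum fun y hy => ?_
        by_cases hyY : y ∈ Y
        · simp only [hyY, if_true]
          exact ((card_le_card (filter_subset _ _)).trans hRc.le).trans (Nat.le_add_left _ _)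
        · have : ¬ t ≤ (R.filter (fun x => Gᶜ.Adj x y)).card :=
            fun h => hyY (mem_filter.2 ⟨hy, h⟩)
          omega
    _ = t * Z.card + T * Y.card := by
        rw [sum_add_distrib, sum_const, ← sum_filter, sum_const, filter_mem_eq_inter,
          inter_eq_right.2 (show Y ⊆ Z from filter_subset _ _), smul_eq_mul, smul_eq_mul,
          mul_comm, mul_comm T]
    _ ≤ _ := by gcongr

open scoped Classical in
-- Peel `T`-cliques off `S`, each costing the previous bound, until fewer than `ρ` vertices remain;
-- these cost at most `ρ * Z.card`.
theorem mul_sum_card_compl_adj_le (G : SimpleGraph V) {t T ρ : ℕ} (hT : 0 < T) (htT : t ≤ T)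
    (hG : ¬ HasSeparatedCliques G t) {Z : Finset V} (hZ : CliqueRich G T ρ Z) :
    ∀ S ⊆ Z, T * ∑ x ∈ S, (Z.filter (Gᶜ.Adj x)).card ≤
      S.card * (t * Z.card + T * (2 ^ T * ρ)) + T * (ρ * Z.card) := by
  intro S
  induction S using Finset.strongInduction with
  | H S ih =>
    intro hS
    by_cases hρ : ρ ≤ S.card
    · obtain ⟨R, hRS, hRc, hR⟩ := hZ S hS hρ
      have hne : R.Nonempty := card_pos.1 (hRc ▸ hT)
      have h1 := ih (S \ R) (sdiff_ssubset hRS hne) (sdiff_subset.trans hS)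
      have h2 := sum_card_compl_adj_clique_le G htT hG hZ hRc hR
      have h3 := card_sdiff_add_card_eq_card hRS
      rw [← sum_sdiff hRS, ← h3, hRc]
      nlinarith [Nat.mul_le_mul_left T h2]
    · have : ∑ x ∈ S, (Z.filter (Gᶜ.Adj x)).card ≤ ρ * Z.card := by
        calc _ ≤ ∑ _x ∈ S, Z.card := sum_le_sum fun x _ => card_le_card (filter_subset _ _)
          _ = S.card * Z.card := by simp
          _ ≤ _ := by gcongr; omega
      exact (Nat.mul_le_mul_left T this).trans (Nat.le_add_left _ _)

/-! ### Degree counting across the split -/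

open scoped Classical in
theorem exists_separatedCliques [Fintype V] (G : SimpleGraph V) {ε : ℝ} (hε : 0 < ε) {t K : ℕ}
    (ht : 0 < t) (hK : 3 / ε ≤ K) (hn : 2 ^ (10 * (t * K)) ≤ Fintype.card V)
    (hdeg : ∀ v, (1 / 4 + ε) * Fintype.card V ≤ (univ.filter (G.Adj v)).card)
    (hdeg' : ∀ v, (1 / 4 + ε) * Fintype.card V ≤ (univ.filter (Gᶜ.Adj v)).card) :
    HasSeparatedCliques G t ∨ HasSeparatedCliques Gᶜ t := by
  by_contra hcon
  rw [not_or] at hcon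
  obtain ⟨hG, hG'⟩ := hcon
  have hK0 : 0 < K := by
    have : (0 : ℝ) < K := lt_of_lt_of_le (by positivity) hK
    exact_mod_cast this
  set n := Fintype.card V with hn_def
  set T := t * K with hT_def
  have hT : 0 < T := Nat.mul_pos ht hK0
  have htT : t ≤ T := Nat.le_mul_of_pos_right t hK0
  set q := 2 ^ T with hq
  have hq0 : 0 < q := by positivity
  have hKq : K < q := lt_of_le_of_lt (Nat.le_mul_of_pos_left K ht) (Nat.lt_two_pow_self)
  have hnq : q ^ 10 ≤ n := by rw [hq, ← pow_mul, mul_comm]; exact hn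
  -- Block size `q ^ 6` suits both thresholds: `k * q ^ 6 ≤ n` makes `k * q ^ 2 + 1` small relative
  -- to `n`.
  obtain ⟨B, hA, k, hk, hB⟩ := exists_cliqueRich_split G T (q ^ 6) (by positivity)
  -- the common richness threshold `ρ` satisfies `ρ q ^ 3 ≤ n`
  obtain ⟨ρ, hρA, hρB, hρ⟩ : ∃ ρ, q ^ 6 ≤ ρ ∧ k * 2 ^ (T + T) + 1 ≤ ρ ∧ ρ * q ^ 3 ≤ n := by
    have hqq : 2 ^ (T + T) = q ^ 2 := by rw [hq, ← pow_mul]; ring_nf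
    have h2q : 2 ≤ q := by
      calc 2 = 2 ^ 1 := rfl
        _ ≤ _ := Nat.pow_le_pow_right (by norm_num) hT
    rw [hqq]
    rcases le_total (q ^ 6) (k * q ^ 2 + 1) with h | h
    · refine ⟨_, h, le_rfl, ?_⟩
      by_cases hk0 : k = 0
      · subst hk0
        simp only [zero_mul, zero_add, one_mul]
        exact (Nat.pow_le_pow_right hq0 (by norm_num)).trans hnq
      · have : 1 ≤ k := Nat.one_le_iff_ne_zero.2 hk0
        calc (k * q ^ 2 + 1) * q ^ 3 ≤ (k * q ^ 2 + k * q ^ 2) * q ^ 3 := by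
              gcongr
              exact Nat.mul_pos this (by positivity)
          _ = 2 * (k * q ^ 5) := by ring
          _ ≤ q * (k * q ^ 5) := by gcongr
          _ = k * q ^ 6 := by ring
          _ ≤ n := hk
    · refine ⟨_, le_rfl, h, ?_⟩
      rw [← pow_add]
      exact (Nat.pow_le_pow_right hq0 (by norm_num)).trans hnq
  have eA := mul_sum_card_compl_adj_le G hT htT hG (hA.mono hρA) Bᶜ subset_rfl
  have eB : T * ∑ x ∈ B, (B.filter (G.Adj x)).card ≤
      B.card * (t * B.card + T * (2 ^ T * ρ)) + T * (ρ * B.card) := by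
    convert mul_sum_card_compl_adj_le Gᶜ hT htT hG' (hB.mono hρB) B subset_rfl using 6
    rw [compl_compl]
  set eAA := ∑ x ∈ Bᶜ, (Bᶜ.filter (Gᶜ.Adj x)).card with heAA
  set eBB := ∑ x ∈ B, (B.filter (G.Adj x)).card with heBB
  set eAB := ∑ x ∈ Bᶜ, (B.filter (Gᶜ.Adj x)).card with heAB
  set eBA := ∑ x ∈ B, (Bᶜ.filter (G.Adj x)).card with heBA
  have hcross : eAB + eBA = Bᶜ.card * B.card := by
    have h1 : eAB = ∑ y ∈ B, (Bᶜ.filter (fun x => Gᶜ.Adj x y)).card :=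
      sum_card_bipartiteAbove_eq_sum_card_bipartiteBelow _
    rw [h1, heBA, ← sum_add_distrib, mul_comm, ← smul_eq_mul, ← sum_const]
    refine sum_congr rfl fun y hy => ?_
    rw [← card_filter_add_card_filter_not (s := Bᶜ) (G.Adj y), add_comm]
    congr 2
    refine filter_congr fun x hx => ?_
    have hxy : x ≠ y := fun h => mem_compl.1 hx (h ▸ hy)
    simp [SimpleGraph.compl_adj, hxy, G.adj_comm]
  have hsplit : ∀ (p : V → Prop) [DecidablePred p],
      (univ.filter p).card = (Bᶜ.filter p).card + (B.filter p).card := by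
    intro p _
    rw [← card_union_of_disjoint (disjoint_filter_filter disjoint_compl_left), ← filter_union,
      union_comm, union_compl]
  have dA : (Bᶜ.card : ℝ) * ((1 / 4 + ε) * n) ≤ eAA + eAB := by
    have : ∑ x ∈ Bᶜ, (1 / 4 + ε) * (n : ℝ) ≤ ∑ x ∈ Bᶜ, ((univ.filter (Gᶜ.Adj x)).card : ℝ) :=
      sum_le_sum fun x _ => hdeg' x
    rw [sum_const, nsmul_eq_mul] at this
    refine this.trans_eq ?_
    rw [heAA, heAB, ← Nat.cast_add, ← sum_add_distrib, Nat.cast_sum]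
    exact sum_congr rfl fun x _ => by rw [hsplit]
  have dB : (B.card : ℝ) * ((1 / 4 + ε) * n) ≤ eBA + eBB := by
    have : ∑ x ∈ B, (1 / 4 + ε) * (n : ℝ) ≤ ∑ x ∈ B, ((univ.filter (G.Adj x)).card : ℝ) :=
      sum_le_sum fun x _ => hdeg x
    rw [sum_const, nsmul_eq_mul] at this
    refine this.trans_eq ?_
    rw [heBA, heBB, ← Nat.cast_add, ← sum_add_distrib, Nat.cast_sum]
    exact sum_congr rfl fun x _ => by rw [hsplit]
  have hab : Bᶜ.card + B.card = n := card_compl_add_card B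
  clear_value eAA eBB eAB eBA
  generalize Bᶜ.card = a at *
  generalize B.card = b at *
  have hinner : K * (eAA + eBB) ≤ n * (n + 2 * K * (q * ρ)) := by
    have h1 : T * (eAA + eBB) ≤ n * (t * n + T * (q * ρ)) + T * (ρ * n) := by
      calc T * (eAA + eBB) = T * eAA + T * eBB := by ring
        _ ≤ _ := Nat.add_le_add eA eB
        _ ≤ (a * (t * n + T * (q * ρ)) + T * (ρ * a)) +
            (b * (t * n + T * (q * ρ)) + T * (ρ * b)) := by
          gcongr <;> omega
        _ = (a + b) * (t * n + T * (q * ρ)) + T * (ρ * (a + b)) := by ring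
        _ = _ := by rw [hab]
    have h2 : t * (K * (eAA + eBB)) ≤ t * (n * (n + K * (q * ρ)) + K * (ρ * n)) := by
      calc t * (K * (eAA + eBB)) = T * (eAA + eBB) := by rw [hT_def]; ring
        _ ≤ _ := h1
        _ = _ := by rw [hT_def]; ring
    have h3 := Nat.le_of_mul_le_mul_left h2 ht
    have h4 : K * (ρ * n) ≤ n * (K * (q * ρ)) := by
      calc K * (ρ * n) = n * (K * (1 * ρ)) := by ring
        _ ≤ _ := by gcongr; exact hq0
    calc _ ≤ _ := h3
      _ ≤ n * (n + K * (q * ρ)) + n * (K * (q * ρ)) := by gcongr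
      _ = _ := by ring
  have hsmall : 2 * K * (q * ρ) ≤ n := by
    calc 2 * K * (q * ρ) ≤ q * q * (q * ρ) := by
          gcongr
          · calc 2 = 2 ^ 1 := rfl
              _ ≤ _ := Nat.pow_le_pow_right (by norm_num) hT
      _ = ρ * q ^ 3 := by ring
      _ ≤ n := hρ
  have hfin : K * (eAA + eBB) ≤ n * (2 * n) := hinner.trans (by gcongr; omega)
  have hn0 : (0 : ℝ) < n := by exact_mod_cast lt_of_lt_of_le (by positivity) hnq
  have hfinR : (K : ℝ) * (eAA + eBB) ≤ n * (2 * n) := by exact_mod_cast hfin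
  have hcrossR : (eAB : ℝ) + eBA = a * b := by exact_mod_cast hcross
  have habR : (a : ℝ) + b = n := by exact_mod_cast hab
  have hKε : 3 ≤ K * ε := by rwa [div_le_iff₀ hε] at hK
  have hKR : (0 : ℝ) < K := by exact_mod_cast hK0
  have hεn : ε * (n : ℝ) ^ 2 ≤ eAA + eBB := by
    have h1 : (n : ℝ) * ((1 / 4 + ε) * n) ≤ eAA + eBB + a * b := by
      calc (n : ℝ) * ((1 / 4 + ε) * n) = a * ((1 / 4 + ε) * n) + b * ((1 / 4 + ε) * n) := by
            rw [← add_mul, habR]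
        _ ≤ _ := by linarith
    have h2 : (a : ℝ) * b ≤ n ^ 2 / 4 := by
      rw [← habR]
      nlinarith [sq_nonneg ((a : ℝ) - b)]
    linarith
  -- `3n² ≤ Kεn² ≤ K(eAA + eBB) ≤ 2n²` is absurd.
  nlinarith [mul_le_mul_of_nonneg_left hεn hKR.le, mul_le_mul_of_nonneg_right hKε (sq_nonneg (n:ℝ)),
    sq_pos_of_pos hn0]

/-! ### Blow-ups and induced `K_{t,t}` as separated cliques -/

theorem labelGraph_swap (χ : Colouring V) (c : Colour) :
    χ.labelGraph c.swap = (χ.labelGraph c)ᶜ := by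
  ext x y
  simp only [SimpleGraph.TopEdgeLabeling.labelGraph_adj, SimpleGraph.compl_adj, not_exists]
  constructor
  · rintro ⟨h, hc⟩
    refine ⟨h, fun h' hc' => ?_⟩
    rw [hc'] at hc
    cases c <;> simp [Colour.swap] at hc
  · rintro ⟨h, hc⟩
    refine ⟨h, ?_⟩
    have := hc h
    cases c <;> cases h' : χ.get x y h <;> simp_all [Colour.swap]

theorem containsBlowUp_const_iff (χ : Colouring V) (t : ℕ) (c : Colour)
    (H : TotallyColouredGraph (Fin 2)) (hg : H.graph = ⊤)
    (hv : ∀ i, H.vertexColour i = c) (he : ∀ i j h, H.edgeColour.get i j h = c.swap) :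
    ContainsBlowUp χ t H ↔ HasSeparatedCliques (χ.labelGraph c) t := by
  unfold ContainsBlowUp HasSeparatedCliques
  rw [← labelGraph_swap]
  simp only [hv, he, hg]
  constructor
  · rintro ⟨S, hc, -, hcl, hadj⟩
    exact ⟨S 0, S 1, hc 0, hc 1, fun x hx y hy hne => hcl 0 x hx y hy hne,
      fun x hx y hy hne => hcl 1 x hx y hy hne, hadj 0 1 (by simp)⟩
  · rintro ⟨S, S', hS, hS', hcl, hcl', hadj⟩
    have hd : Disjoint S S' := disjoint_left.2 fun x hx hx' => (hadj x hx x hx').ne rfl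
    refine ⟨![S, S'], ?_, ?_, ?_, ?_⟩
    · simp [Fin.forall_fin_two, hS, hS']
    · simp [Fin.forall_fin_two, hd, hd.symm]
    · simp only [Fin.forall_fin_two]
      exact ⟨fun x hx y hy hne => hcl hx hy hne, fun x hx y hy hne => hcl' hx hy hne⟩
    · simp only [Fin.forall_fin_two]
      exact ⟨⟨fun h => absurd h (by simp), fun _ => hadj⟩,
        ⟨fun _ x hx y hy => (hadj y hy x hx).symm, fun h => absurd h (by simp)⟩⟩

theorem containsBlowUp_P₁_iff (χ : Colouring V) (t : ℕ) :
    ContainsBlowUp χ t P₁ ↔ HasSeparatedCliques (χ.labelGraph .red) t :=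
  containsBlowUp_const_iff χ t .red P₁ rfl (fun _ => rfl) (fun _ _ _ => rfl)

theorem containsBlowUp_P₁_bar_iff (χ : Colouring V) (t : ℕ) :
    ContainsBlowUp χ t P₁.bar ↔ HasSeparatedCliques (χ.labelGraph .blue) t :=
  containsBlowUp_const_iff χ t .blue P₁.bar rfl (fun _ => rfl) (fun _ _ _ => rfl)

theorem HasSeparatedCliques.exists_iso {G : SimpleGraph V} {t : ℕ}
    (h : HasSeparatedCliques G t) :
    ∃ S : Finset V, S.card = 2 * t ∧
      Nonempty (Gᶜ.induce (S : Set V) ≃g completeBipartiteGraph (Fin t) (Fin t)) := by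
  classical
  obtain ⟨S, S', hS, hS', hcl, hcl', hadj⟩ := h
  have hd : Disjoint S S' := disjoint_left.2 fun x hx hx' => (hadj x hx x hx').ne rfl
  refine ⟨S ∪ S', by rw [card_union_of_disjoint hd, hS, hS']; ring, ?_⟩
  let e := S.equivFinOfCardEq hS
  let e' := S'.equivFinOfCardEq hS'
  let f : Fin t ⊕ Fin t → ((S ∪ S' : Finset V) : Set V) := Sum.elim
    (fun i => ⟨e.symm i, by simp⟩) (fun i => ⟨e'.symm i, by simp⟩)
  have hf : Function.Bijective f := by
    rw [Fintype.bijective_iff_injective_and_card]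
    constructor
    · intro a b hij
      have hval : (f a : V) = f b := congrArg Subtype.val hij
      rcases a with i | i <;> rcases b with j | j
      · have : (e.symm i : V) = e.symm j := hval
        simpa [Subtype.ext_iff] using this
      · have : (e.symm i : V) = e'.symm j := hval
        exact absurd (this ▸ (e'.symm j).2) (disjoint_left.1 hd (e.symm i).2)
      · have : (e'.symm i : V) = e.symm j := hval
        exact absurd (this ▸ (e'.symm i).2) (disjoint_left.1 hd (e.symm j).2)
      · have : (e'.symm i : V) = e'.symm j := hval
        simpa [Subtype.ext_iff] using this
    · simp [card_union_of_disjoint hd, hS, hS']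
  refine ⟨SimpleGraph.Iso.symm ⟨Equiv.ofBijective f hf, ?_⟩⟩
  rintro (i | i) (j | j)
  · simp only [Equiv.ofBijective_apply, SimpleGraph.induce_adj, f, Sum.elim_inl,
      SimpleGraph.compl_adj, completeBipartiteGraph_adj]
    simpa using fun hne => hcl (e.symm i).2 (e.symm j).2 hne
  · simpa [f] using hadj _ (e.symm i).2 _ (e'.symm j).2
  · simpa [f] using (hadj _ (e.symm j).2 _ (e'.symm i).2).symm
  · simp only [Equiv.ofBijective_apply, SimpleGraph.induce_adj, f, Sum.elim_inr,
      SimpleGraph.compl_adj, completeBipartiteGraph_adj]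
    simpa using fun hne => hcl' (e'.symm i).2 (e'.symm j).2 hne

theorem HasSeparatedCliques.of_iso {G : SimpleGraph V} {t : ℕ} {S : Finset V}
    (φ : Gᶜ.induce (S : Set V) ≃g completeBipartiteGraph (Fin t) (Fin t)) :
    HasSeparatedCliques G t := by
  classical
  let g : Fin t ⊕ Fin t ↪ V := φ.symm.toEquiv.toEmbedding.trans (Function.Embedding.subtype _)
  have hg : ∀ i j, Gᶜ.Adj (g i) (g j) ↔ (completeBipartiteGraph (Fin t) (Fin t)).Adj i j :=
    fun i j => φ.symm.map_rel_iff' (a := i) (b := j)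
  have hg' : ∀ i j, g i ≠ g j → ¬ (completeBipartiteGraph (Fin t) (Fin t)).Adj i j →
      G.Adj (g i) (g j) := by
    intro i j hne hn
    rw [← hg, SimpleGraph.compl_adj] at hn
    by_contra h
    exact hn ⟨hne, h⟩
  refine ⟨univ.map (Function.Embedding.inl.trans g), univ.map (Function.Embedding.inr.trans g),
    by simp, by simp, ?_, ?_, ?_⟩
  · intro x hx y hy hne
    simp only [coe_map, coe_univ, Set.image_univ, Set.mem_range] at hx hy
    obtain ⟨i, rfl⟩ := hx
    obtain ⟨j, rfl⟩ := hy
    exact hg' _ _ hne (by simp)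
  · intro x hx y hy hne
    simp only [coe_map, coe_univ, Set.image_univ, Set.mem_range] at hx hy
    obtain ⟨i, rfl⟩ := hx
    obtain ⟨j, rfl⟩ := hy
    exact hg' _ _ hne (by simp)
  · intro x hx y hy
    obtain ⟨i, -, rfl⟩ := mem_map.1 hx
    obtain ⟨j, -, rfl⟩ := mem_map.1 hy
    exact (hg _ _).2 (by simp)

theorem Colour.swap_swap (c : Colour) : c.swap.swap = c := by cases c <;> rfl

theorem hasInducedBipartite_iff (χ : Colouring V) (t : ℕ) :
    HasInducedBipartite χ t ↔ ∃ c, HasSeparatedCliques (χ.labelGraph c) t := by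
  constructor
  · rintro ⟨c, S, -, ⟨φ⟩⟩
    rw [← Colour.swap_swap c, labelGraph_swap] at φ
    exact ⟨c.swap, .of_iso φ⟩
  · rintro ⟨c, h⟩
    obtain ⟨S, hS, hφ⟩ := h.exists_iso
    rw [← labelGraph_swap] at hφ
    exact ⟨c.swap, S, hS, hφ⟩

/-! ### The extremal colouring -/

theorem fourPart_labelGraph_adj {k : ℕ} {c : Colour} {x y : Fin 4 × Fin k} :
    ((fourPart k).labelGraph c).Adj x y ↔ x ≠ y ∧ partColour x.1 y.1 = c := by
  rw [SimpleGraph.TopEdgeLabeling.labelGraph_adj]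
  exact ⟨fun ⟨h, hc⟩ => ⟨h, hc⟩, fun ⟨h, hc⟩ => ⟨h, hc⟩⟩

/-- Two vertices from each clique already give a contradiction, so a finite check on parts suffices;
parts may coincide. -/
theorem partColour_no_separated (c : Colour) : ∀ i i' j j' : Fin 4,
    ¬ (partColour i i' = c ∧ partColour j j' = c ∧ partColour i j ≠ c ∧ partColour i j' ≠ c ∧
      partColour i' j ≠ c ∧ partColour i' j' ≠ c) := by
  cases c <;> decide

theorem not_hasSeparatedCliques_fourPart {k t : ℕ} (ht : 2 ≤ t) (c : Colour) :
    ¬ HasSeparatedCliques ((fourPart k).labelGraph c) t := by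
  rintro ⟨S, S', hS, hS', hcl, hcl', hadj⟩
  obtain ⟨x, hx, x', hx', hxx⟩ := one_lt_card.1 (show 1 < S.card by omega)
  obtain ⟨y, hy, y', hy', hyy⟩ := one_lt_card.1 (show 1 < S'.card by omega)
  have hcross : ∀ a ∈ S, ∀ b ∈ S', partColour a.1 b.1 ≠ c := by
    intro a ha b hb h
    have hab := hadj a ha b hb
    rw [SimpleGraph.compl_adj, fourPart_labelGraph_adj] at hab
    exact hab.2 ⟨hab.1, h⟩
  have h1 := (fourPart_labelGraph_adj.1 (hcl hx hx' hxx)).2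
  have h2 := (fourPart_labelGraph_adj.1 (hcl' hy hy' hyy)).2
  exact partColour_no_separated c _ _ _ _ ⟨h1, h2, hcross x hx y hy, hcross x hx y' hy',
    hcross x' hx' y hy, hcross x' hx' y' hy'⟩

theorem exists_part_of_colour (c : Colour) : ∀ i : Fin 4, ∃ j, j ≠ i ∧ partColour i j = c := by
  cases c <;> decide

theorem locallyBalanced_fourPart (k : ℕ) : LocallyBalanced (1 / 4) (fourPart k) := by
  intro v c
  -- A whole part other than that of `v` supplies `k` neighbours; `j ≠ v.1` avoids losing `v`
  -- itself.
  obtain ⟨j, hj, hc⟩ := exists_part_of_colour c v.1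
  have hsub : Set.range (fun a : Fin k => (j, a)) ⊆
      ((fourPart k).labelGraph c).neighborSet v := by
    rintro _ ⟨a, rfl⟩
    exact fourPart_labelGraph_adj.2 ⟨fun h => hj (by rw [h]), hc⟩
  have hle := Set.ncard_le_ncard hsub (Set.toFinite _)
  rw [← Set.image_univ, Set.ncard_image_of_injective _ (Prod.mk_right_injective j),
    Set.ncard_univ, Nat.card_fin] at hle
  have : (k : ℝ) ≤ (((fourPart k).labelGraph c).neighborSet v).ncard := by exact_mod_cast hle
  simp only [Fintype.card_prod, Fintype.card_fin]
  push_cast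
  linarith

/-! ### Numerical bounds and conclusion -/

open scoped Classical in
theorem LocallyBalanced.le_card_filter [Fintype V] {δ : ℝ} {χ : Colouring V}
    (h : LocallyBalanced δ χ) (c : Colour) (v : V) :
    δ * Fintype.card V ≤ (univ.filter ((χ.labelGraph c).Adj v)).card := by
  refine (h v c).trans_eq ?_
  rw [← Set.ncard_coe_finset]
  congr 2
  ext; simp

/-- This forces `ε < 1/4`, hence `log (1 / ε) ≥ 1`, so its eighth power dominates it. -/
theorem LocallyBalanced.lt_half [Fintype V] [Nonempty V] {δ : ℝ} {χ : Colouring V}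
    (h : LocallyBalanced δ χ) : δ < 1 / 2 := by
  classical
  obtain ⟨v⟩ := ‹Nonempty V›
  have h1 := h.le_card_filter .red v
  have h2 := h.le_card_filter .blue v
  have hd : Disjoint (univ.filter ((χ.labelGraph .red).Adj v))
      (univ.filter ((χ.labelGraph .blue).Adj v)) := by
    rw [disjoint_filter]
    intro x _ hr hb
    rw [show Colour.blue = Colour.red.swap from rfl, labelGraph_swap] at hb
    exact hb.2 hr
  have h3 : (univ.filter ((χ.labelGraph .red).Adj v)).card +
      (univ.filter ((χ.labelGraph .blue).Adj v)).card < Fintype.card V := by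
    rw [← card_union_of_disjoint hd, ← card_univ]
    exact card_lt_card ((ssubset_univ_iff).2 fun he => by
      have := he ▸ mem_univ v
      simp at this)
  have h3' : ((univ.filter ((χ.labelGraph .red).Adj v)).card : ℝ) +
      (univ.filter ((χ.labelGraph .blue).Adj v)).card < Fintype.card V := by exact_mod_cast h3
  have hn : (0 : ℝ) < Fintype.card V := by exact_mod_cast Fintype.card_pos_iff.2 ⟨v⟩
  nlinarith

theorem ten_mul_ceil_le {ε : ℝ} (hε : 0 < ε) (hε4 : ε < 1 / 4) :
    (10 : ℝ) * (⌈3 / ε⌉₊ : ℝ) ≤ 2 ^ (10 * Real.log (1 / ε) ^ 8) := by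
  have hinv : 4 < 1 / ε := by rw [lt_div_iff₀ hε]; linarith
  set L := Real.log (1 / ε) with hL
  have hexp : Real.exp L = 1 / ε := Real.exp_log (by positivity)
  have hL1 : 1 ≤ L := by
    rw [hL, Real.le_log_iff_exp_le (by positivity)]
    linarith [Real.exp_one_lt_d9]
  have hL8 : L ≤ L ^ 8 := le_self_pow₀ hL1 (by norm_num)
  have h2 : (1 : ℝ) / 2 ≤ Real.log 2 := by linarith [Real.log_two_gt_d9]
  calc (10 : ℝ) * (⌈3 / ε⌉₊ : ℝ) ≤ 10 * (3 / ε + 1) := by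
        gcongr
        exact (Nat.ceil_lt_add_one (by positivity)).le
    _ ≤ (1 / ε) ^ 5 := by
        rw [show 3 / ε = 3 * (1 / ε) by ring]
        generalize 1 / ε = x at *
        have : 4 ^ 4 * x ≤ x ^ 4 * x := by gcongr
        nlinarith
    _ = Real.exp (5 * L) := by
        rw [← hexp, ← Real.exp_nat_mul]; norm_num
    _ ≤ Real.exp (Real.log 2 * (10 * L ^ 8)) := by
        apply Real.exp_le_exp.2
        nlinarith
    _ = 2 ^ (10 * L ^ 8) := by rw [Real.rpow_def_of_pos (by norm_num)]

theorem exists_hasSeparatedCliques_labelGraph {ε : ℝ} (hε : 0 < ε) {t n : ℕ}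
    (hn : (2 : ℝ) ^ ((t : ℝ) * (2 : ℝ) ^ (10 * Real.log (1 / ε) ^ 8)) ≤ n)
    {χ : Colouring (Fin n)} (hχ : LocallyBalanced (1 / 4 + ε) χ) :
    HasSeparatedCliques (χ.labelGraph .red) t ∨ HasSeparatedCliques (χ.labelGraph .blue) t := by
  classical
  rcases Nat.eq_zero_or_pos t with rfl | ht
  · exact Or.inl ⟨∅, ∅, by simp⟩
  have hn0 : 0 < n := by
    have : (0 : ℝ) < n := lt_of_lt_of_le (by positivity) hn
    exact_mod_cast this
  have : Nonempty (Fin n) := ⟨⟨0, hn0⟩⟩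
  have hε4 : ε < 1 / 4 := by linarith [hχ.lt_half]
  have hcard : 2 ^ (10 * (t * ⌈3 / ε⌉₊)) ≤ n := by
    have h : (2 : ℝ) ^ (10 * (t * ⌈3 / ε⌉₊)) ≤ n := by
      refine le_trans ?_ hn
      rw [← Real.rpow_natCast]
      refine Real.rpow_le_rpow_of_exponent_le (by norm_num) ?_
      push_cast
      have := mul_le_mul_of_nonneg_left (ten_mul_ceil_le hε hε4) (Nat.cast_nonneg (α := ℝ) t)
      linarith
    exact_mod_cast h
  rw [show Colour.blue = Colour.red.swap from rfl, labelGraph_swap]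
  refine exists_separatedCliques _ hε ht (Nat.le_ceil _) (by simpa using hcard)
    (fun v => ?_) fun v => ?_
  · convert hχ.le_card_filter .red v
  convert hχ.le_card_filter .blue v using 4
  rw [show Colour.blue = Colour.red.swap from rfl, labelGraph_swap]

end BalancedRamsey

theorem mainTheorem2 :
    (∃ C : ℝ, 0 < C ∧ ∀ ε : ℝ, 0 < ε → ∀ t n : ℕ,
      (2 : ℝ) ^ ((t : ℝ) * (2 : ℝ) ^ (C * (Real.log (1 / ε)) ^ 8)) ≤ (n : ℝ) →
      ∀ χ : BalancedRamsey.Colouring (Fin n),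
        BalancedRamsey.LocallyBalanced (1 / 4 + ε) χ →
        (BalancedRamsey.ContainsBlowUp χ t BalancedRamsey.P₁ ∨
          BalancedRamsey.ContainsBlowUp χ t BalancedRamsey.P₁.bar) ∧
        BalancedRamsey.HasInducedBipartite χ t) ∧
    (∀ k : ℕ, 1 ≤ k →
      BalancedRamsey.LocallyBalanced (1 / 4) (BalancedRamsey.fourPart k) ∧
      ∀ t : ℕ, 2 ≤ t →
        ¬ BalancedRamsey.ContainsBlowUp (BalancedRamsey.fourPart k) t BalancedRamsey.P₁ ∧
        ¬ BalancedRamsey.ContainsBlowUp (BalancedRamsey.fourPart k) t BalancedRamsey.P₁.bar ∧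
        ¬ BalancedRamsey.HasInducedBipartite (BalancedRamsey.fourPart k) t) := by
  simp only [BalancedRamsey.containsBlowUp_P₁_iff, BalancedRamsey.containsBlowUp_P₁_bar_iff,
    BalancedRamsey.hasInducedBipartite_iff]
  refine ⟨⟨10, by norm_num, fun ε hε t n hn χ hχ => ?_⟩, fun k _ =>
    ⟨BalancedRamsey.locallyBalanced_fourPart k, fun t ht =>
      ⟨BalancedRamsey.not_hasSeparatedCliques_fourPart ht _,
        BalancedRamsey.not_hasSeparatedCliques_fourPart ht _,
        fun ⟨c, hc⟩ => BalancedRamsey.not_hasSeparatedCliques_fourPart ht c hc⟩⟩⟩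
  have h := BalancedRamsey.exists_hasSeparatedCliques_labelGraph hε hn hχ
  exact ⟨h, h.elim (fun h => ⟨_, h⟩) fun h => ⟨_, h⟩⟩
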